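/- Let $(X,d)$ be a compact metric space and write $\mathbb N=\{1,2,\dots\}$, $\mathbb Z^*=\mathbb Z\setminus\{0\}$. Let $\Sigma=\{\alpha_n:n\in\mathbb Z^*\}$ be an alphabet, $\upsilon\notin\Sigma$ a variable, and $\vec k=(k_n)_{n\in\mathbb Z^*}\subseteq\mathbb N$ such that $(k_n)_{n\in\mathbb N}$ and $(k_{-n})_{n\in\mathbb N}$ are (weakly) increasing. Definitions. A located word is a function $w=(w_n)_{n\in \mathrm{dom}(w)}$ on a non-empty finite set $\mathrm{dom}(w)\subset\mathbb Z^*$; put $\mathrm{dom}^{\pm}(w)=\{n\in\mathrm{dom}(w):\pm n>0\}$. $\widetilde L(\Sigma,\vec k)$ is the set of located words with $w_n\in\{\alpha_1,\dots,\alpha_{k_n}\}$ for $n\in\mathrm{dom}^+(w)$ and $w_n\in\{\alpha_{-k_n},\dots,\alpha_{-1}\}$ for $n\in\mathrm{dom}^-(w)$. $\widetilde L_0(\Sigma,\vec k;\upsilon)$ is the set of located words whose letters are each $\upsilon$ or as above, and in which $\upsilon$ occurs both at some negative and at some positive position. $L(\Sigma,\vec k)$ is the set of $w\in\widetilde L(\Sigma,\vec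 k)$ with $\mathrm{dom}(w)\subset\mathbb N$, and $L(\Sigma,\vec k;\upsilon)$ is the set of located words with $\mathrm{dom}(w)\subset\mathbb N$ whose letters are each $\upsilon$ or as above, and in which $\upsilon$ occurs. For words with disjoint domains, $w\star u$ is their common extension to $\mathrm{dom}(w)\cup\mathrm{dom}(u)$. Write $w<_{R_2}u$ if $\max\mathrm{dom}(w)<\min\mathrm{dom}(u)$, and $w<_{R_1}u$ if $\mathrm{dom}(u)=A_1\cup A_2$ with $A_1,A_2\ne\emptyset$ and $\max A_1<\min\mathrm{dom}(w)\le\max\mathrm{dom}(w)<\min A_2$. $\widetilde L^\infty(\Sigma,\vec k;\upsilon)$ (resp. $L^\infty(\Sigma,\vec k;\upsilon)$) is the set of sequences $\vec w=(w_n)_{n\in\mathbb N}$ in $\widetilde L_0(\Sigma,\vec k;\upsilon)$ with $w_n<_{R_1}w_{n+1}$ for all $n$ (resp. in $L(\Sigma,\vec k;\upsilon)$ with $w_n<_{R_2}w_{n+1}$ for all $n$). The word $w(p,q)$ is obtained from $w$ by replacing $\upsilon$ by $\alpha_p$ at positive and by $\alpha_{-q}$ at negative positions; $w(\upsilon,\upsilon)=w$;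 in the second case $w(p)$ is obtained by replacing $\upsilon$ by $\alpha_p$, and $w(\upsilon)=w$. For $\vec w\in\widetilde L^\infty(\Sigma,\vec k;\upsilon)$, $\widetilde E(\vec w)$ is the set of words in $\widetilde L(\Sigma,\vec k)$ of the form $w_{n_1}(p_1,q_1)\star\dots\star w_{n_\lambda}(p_\lambda,q_\lambda)$ with $\lambda\in\mathbb N$, $n_1<\dots<n_\lambda$ in $\mathbb N$, $1\le p_i\le k_{n_i}$ and $1\le q_i\le k_{-n_i}$; an extraction $\vec u\prec\vec w$ is a sequence $\vec u\in\widetilde L^\infty(\Sigma,\vec k;\upsilon)$ each of whose terms has this form and lies in $\widetilde L_0(\Sigma,\vec k;\upsilon)$, where now the pairs $(p_i,q_i)$ may also be $(\upsilon,\upsilon)$ and at least one of them is. For $\vec w\in L^\infty(\Sigma,\vec k;\upsilon)$, $E(\vec w)$ and $\vec u\prec\vec w$ are defined in the same way with $L(\Sigma,\vec k)$, $L(\Sigma,\vec k;\upsilon)$, $L^\infty(\Sigma,\vec k;\upsilon)$ and words $w_{n_i}(p_i)$, $1\le p_i\le k_{n_i}$ (or $p_i=\upsilon$). $R_1$-$\lim_{w\in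 S}x_w=x_0$ means: for every neighbourhood $V$ of $x_0$ there is $n_0\in\mathbb N$ with $x_w\in V$ for all $w\in S$ with $\min\{-\max\mathrm{dom}^-(w),\min\mathrm{dom}^+(w)\}\ge n_0$. $R_2$-$\lim_{w\in S}x_w=x_0$ means the same with the condition $\min\mathrm{dom}(w)\ge n_0$. Theorem. (a) For every $\vec w\in\widetilde L^\infty(\Sigma,\vec k;\upsilon)$ and every family $\{x_w\}_{w\in\widetilde L(\Sigma,\vec k)}\subseteq X$ there exist an extraction $\vec u\prec\vec w$ and $x_0\in X$ such that $R_1$-$\lim_{w\in\widetilde E(\vec u)}x_w=x_0$. (b) For every $\vec w\in L^\infty(\Sigma,\vec k;\upsilon)$ and every family $\{x_w\}_{w\in L(\Sigma,\vec k)}\subseteq X$ there exist an extraction $\vec u\prec\vec w$ and $x_0\in X$ such that $R_2$-$\lim_{w\in E(\vec u)}x_w=x_0$. -/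

import Mathlib

open scoped Topology

/-- A located word with letters in `A`: a function from a non-empty finite set `dom` of non-zero
integers to `A`, recorded as a partial function on `ℤ` (`none` off the domain). -/
@[ext]
structure LocWord (A : Type*) where
  /-- the partial function -/
  letter : ℤ → Option A
  /-- the domain -/
  dom : Finset ℤ
  mem_dom : ∀ n, n ∈ dom ↔ letter n ≠ none
  nonempty : dom.Nonempty
  zero_notMem : (0 : ℤ) ∉ dom

namespace LocWord

variable {A : Type*}

/-- `dom⁻(w)` -/
def domNeg (w : LocWord A) : Finset ℤ := w.dom.filter (fun n => n < 0)

/-- `dom⁺(w)` -/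
def domPos (w : LocWord A) : Finset ℤ := w.dom.filter (fun n => 0 < n)

/-- The letters of the alphabet `{α i : i ≠ 0}` allowed at position `n`: these are
`α 1, …, α (k n)` if `0 < n`, and `α (-k n), …, α (-1)` if `n < 0`. -/
def allowed (α : ℤ → A) (k : ℤ → ℕ) (n : ℤ) : Set A :=
  {a | ∃ i : ℤ, ((0 < n ∧ 1 ≤ i ∧ i ≤ (k n : ℤ)) ∨ (n < 0 ∧ -(k n : ℤ) ≤ i ∧ i ≤ -1)) ∧ α i = a}

/-- The `ω`-`ℤ*`-located words over `α` dominated by `k`. -/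
def Ltilde (α : ℤ → A) (k : ℤ → ℕ) : Set (LocWord A) :=
  {w | ∀ n a, w.letter n = some a → a ∈ allowed α k n}

/-- The `ω`-located words over `α` dominated by `k` (only positive positions occur). -/
def L (α : ℤ → A) (k : ℤ → ℕ) : Set (LocWord A) :=
  {w | (∀ n ∈ w.dom, 0 < n) ∧ ∀ n a, w.letter n = some a → a ∈ allowed α k n}

/-- The variable `ω`-`ℤ*`-located words; `υ` is the variable. -/
def LtildeVar (α : ℤ → A) (k : ℤ → ℕ) (υ : A) : Set (LocWord A) :=
  {w | (∀ n a, w.letter n = some a → a = υ ∨ a ∈ allowed α k n) ∧ ∃ n, w.letter n = some υ}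

/-- The variable `ω`-located words; `υ` is the variable. -/
def LVar (α : ℤ → A) (k : ℤ → ℕ) (υ : A) : Set (LocWord A) :=
  {w | (∀ n ∈ w.dom, 0 < n) ∧
    (∀ n a, w.letter n = some a → a = υ ∨ a ∈ allowed α k n) ∧ ∃ n, w.letter n = some υ}

/-- The variable `ω`-`ℤ*`-located words in which the variable occurs both at a negative and at a
positive position. -/
def LtildeVar₀ (α : ℤ → A) (k : ℤ → ℕ) (υ : A) : Set (LocWord A) :=
  {w | w ∈ LtildeVar α k υ ∧
    (∃ i ∈ w.domNeg, w.letter i = some υ) ∧ ∃ i ∈ w.domPos, w.letter i = some υ}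

/-- The concatenation `w ⋆ u` of two words. It is only used for words with disjoint domains; for
other words the letters of `w` take precedence. -/
def star (w u : LocWord A) : LocWord A where
  letter n := (w.letter n).or (u.letter n)
  dom := w.dom ∪ u.dom
  mem_dom n := by
    rw [Finset.mem_union, w.mem_dom, u.mem_dom]
    cases w.letter n <;> simp
  nonempty := w.nonempty.mono Finset.subset_union_left
  zero_notMem := by simp [w.zero_notMem, u.zero_notMem]

/-- The concatenation `w ⋆ v₁ ⋆ … ⋆ vᵣ` of a non-empty list of words. -/
def concat (w : LocWord A) (l : List (LocWord A)) : LocWord A := l.foldl star w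

/-- `w <_{R₁} u` -/
def R₁ (w u : LocWord A) : Prop :=
  ∃ A₁ A₂ : Finset ℤ, A₁.Nonempty ∧ A₂.Nonempty ∧ u.dom = A₁ ∪ A₂ ∧
    (∀ a ∈ A₁, ∀ n ∈ w.dom, a < n) ∧ ∀ n ∈ w.dom, ∀ b ∈ A₂, n < b

/-- `w <_{R₂} u` -/
def R₂ (w u : LocWord A) : Prop := ∀ n ∈ w.dom, ∀ m ∈ u.dom, n < m

/-- The sequences `(w₁, w₂, …)` in `LtildeVar₀` that increase for `R₁`. -/
def LtildeInf (α : ℤ → A) (k : ℤ → ℕ) (υ : A) : Set (ℕ+ → LocWord A) :=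
  {w | (∀ n, w n ∈ LtildeVar₀ α k υ) ∧ ∀ n, R₁ (w n) (w (n + 1))}

/-- The sequences `(w₁, w₂, …)` in `LVar` that increase for `R₂`. -/
def LInf (α : ℤ → A) (k : ℤ → ℕ) (υ : A) : Set (ℕ+ → LocWord A) :=
  {w | (∀ n, w n ∈ LVar α k υ) ∧ ∀ n, R₂ (w n) (w (n + 1))}

open Classical in
/-- Replace every occurrence of the variable `υ` in `w`, at position `n`, by the letter `f n`. -/
noncomputable def replaceVar (υ : A) (f : ℤ → A) (w : LocWord A) : LocWord A where
  letter n := (w.letter n).map (fun a => if a = υ then f n else a)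
  dom := w.dom
  mem_dom n := by rw [w.mem_dom]; simp
  nonempty := w.nonempty
  zero_notMem := w.zero_notMem

/-- The substitution `w(p, q)`: the variable becomes `α p` at positive and `α (-q)` at negative
positions. The argument `none` stands for `(υ, υ)`, with `w(υ, υ) = w`. -/
noncomputable def substTilde (α : ℤ → A) (υ : A) (w : LocWord A) : Option (ℕ × ℕ) → LocWord A
  | none => w
  | some (p, q) => replaceVar υ (fun n => if 0 < n then α (p : ℤ) else α (-(q : ℤ))) w

/-- The substitution `w(p)`: the variable becomes `α p`. The argument `none` stands for `υ`, with
`w(υ) = w`. -/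
noncomputable def subst (α : ℤ → A) (υ : A) (w : LocWord A) : Option ℕ → LocWord A
  | none => w
  | some p => replaceVar υ (fun _ => α (p : ℤ)) w

/-- The extracted `ω`-`ℤ*`-located words
`w_{n₁}(p₁, q₁) ⋆ … ⋆ w_{n_λ}(p_λ, q_λ)` of the sequence `w`, where `n₁ < … < n_λ` is the list
`n :: l`, and the pair used at the index `m` of this list is `s m`. -/
def Etilde (α : ℤ → A) (k : ℤ → ℕ) (υ : A) (w : ℕ+ → LocWord A) : Set (LocWord A) :=
  {z | z ∈ Ltilde α k ∧ ∃ (n : ℕ+) (l : List ℕ+) (s : ℕ+ → ℕ × ℕ),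
    (n :: l).Pairwise (· < ·) ∧
    (∀ m ∈ n :: l, 1 ≤ (s m).1 ∧ (s m).1 ≤ k (m : ℤ) ∧ 1 ≤ (s m).2 ∧ (s m).2 ≤ k (-(m : ℤ))) ∧
    z = concat (substTilde α υ (w n) (some (s n)))
      (l.map fun m => substTilde α υ (w m) (some (s m)))}

/-- The extracted `ω`-located words of the sequence `w`. -/
def E (α : ℤ → A) (k : ℤ → ℕ) (υ : A) (w : ℕ+ → LocWord A) : Set (LocWord A) :=
  {z | z ∈ L α k ∧ ∃ (n : ℕ+) (l : List ℕ+) (s : ℕ+ → ℕ),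
    (n :: l).Pairwise (· < ·) ∧
    (∀ m ∈ n :: l, 1 ≤ s m ∧ s m ≤ k (m : ℤ)) ∧
    z = concat (subst α υ (w n) (some (s n))) (l.map fun m => subst α υ (w m) (some (s m)))}

/-- The extracted variable `ω`-`ℤ*`-located words of the sequence `w`: each pair may also be
`(υ, υ)`, and at least one of them is. -/
def EVtilde (α : ℤ → A) (k : ℤ → ℕ) (υ : A) (w : ℕ+ → LocWord A) : Set (LocWord A) :=
  {u | u ∈ LtildeVar₀ α k υ ∧ ∃ (n : ℕ+) (l : List ℕ+) (s : ℕ+ → Option (ℕ × ℕ)),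
    (n :: l).Pairwise (· < ·) ∧
    (∀ m ∈ n :: l, ∀ p q : ℕ, s m = some (p, q) →
      1 ≤ p ∧ p ≤ k (m : ℤ) ∧ 1 ≤ q ∧ q ≤ k (-(m : ℤ))) ∧
    (∃ m ∈ n :: l, s m = none) ∧
    u = concat (substTilde α υ (w n) (s n)) (l.map fun m => substTilde α υ (w m) (s m))}

/-- The extracted variable `ω`-located words of the sequence `w`. -/
def EV (α : ℤ → A) (k : ℤ → ℕ) (υ : A) (w : ℕ+ → LocWord A) : Set (LocWord A) :=
  {u | u ∈ LVar α k υ ∧ ∃ (n : ℕ+) (l : List ℕ+) (s : ℕ+ → Option ℕ),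
    (n :: l).Pairwise (· < ·) ∧
    (∀ m ∈ n :: l, ∀ p : ℕ, s m = some p → 1 ≤ p ∧ p ≤ k (m : ℤ)) ∧
    (∃ m ∈ n :: l, s m = none) ∧
    u = concat (subst α υ (w n) (s n)) (l.map fun m => subst α υ (w m) (s m))}

/-- `u ≺ w` for `u, w` in `LtildeInf`: `u` is an extraction of `w`. -/
def ExtractionTilde (α : ℤ → A) (k : ℤ → ℕ) (υ : A) (u w : ℕ+ → LocWord A) : Prop :=
  u ∈ LtildeInf α k υ ∧ ∀ n, u n ∈ EVtilde α k υ w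

/-- `u ≺ w` for `u, w` in `LInf`: `u` is an extraction of `w`. -/
def Extraction (α : ℤ → A) (k : ℤ → ℕ) (υ : A) (u w : ℕ+ → LocWord A) : Prop :=
  u ∈ LInf α k υ ∧ ∀ n, u n ∈ EV α k υ w

/-- `R₁-lim_{w ∈ S} x_w = x₀`, for a family `x` indexed by a set `T` of words: for every
neighbourhood `V` of `x₀` there is `n₀` with `x_w ∈ V` for all `w ∈ S` such that
`min {-max dom⁻(w), min dom⁺(w)} ≥ n₀`. -/
def R₁Lim {X : Type*} [TopologicalSpace X] {T : Set (LocWord A)} (S : Set (LocWord A))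
    (x : T → X) (x₀ : X) : Prop :=
  ∀ V ∈ 𝓝 x₀, ∃ n₀ : ℕ, ∀ w : T, (w : LocWord A) ∈ S →
    ∀ (hneg : (w : LocWord A).domNeg.Nonempty) (hpos : (w : LocWord A).domPos.Nonempty),
      (n₀ : ℤ) ≤ min (-((w : LocWord A).domNeg.max' hneg)) ((w : LocWord A).domPos.min' hpos) →
        x w ∈ V

/-- `R₂-lim_{w ∈ S} x_w = x₀`, for a family `x` indexed by a set `T` of words: for every
neighbourhood `V` of `x₀` there is `n₀` with `x_w ∈ V` for all `w ∈ S` such that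
`min dom(w) ≥ n₀`. -/
def R₂Lim {X : Type*} [TopologicalSpace X] {T : Set (LocWord A)} (S : Set (LocWord A))
    (x : T → X) (x₀ : X) : Prop :=
  ∀ V ∈ 𝓝 x₀, ∃ n₀ : ℕ, ∀ w : T, (w : LocWord A) ∈ S →
    (n₀ : ℤ) ≤ (w : LocWord A).dom.min' (w : LocWord A).nonempty → x w ∈ V

end LocWord

-- The proof runs in the compact right topological semigroup of ultrafilters on located words. Let
-- `C N` and `V N` be the constant and variable words extracted from `w` with indices at least `N`.
-- Ultrafilters containing every `C N` form a compact subsemigroup, and those containing every `V N`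
-- form another, stable under multiplication by the first on both sides. Take a minimal idempotent
-- `U` of the first and an idempotent `p ≤ U` in the second. Each admissible substitution is a
-- homomorphism fixing constant words, so it sends `p` to a constant idempotent below `U`, which is
-- `U` by minimality (`exists_ultrafilter_map_eq`).
--
-- By compactness `x` converges along `U` to some `x₀`. A Galvin–Glazer construction with `p`-large
-- choices (`exists_seq_foldl_mem`) gives `u` such that every substituted product with first index
-- `n` has its value in the `n`-th basic neighbourhood of `x₀`. A word far from the origin has a
-- large first index, hence the limit. Both halves of the theorem are instances of
-- `IsSubstitutionSystem`.

attribute [local instance] Ultrafilter.mul Ultrafilter.semigroup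

namespace LocWord

/-! ### Idempotents in compact right topological semigroups. -/

section CompactSemigroup

variable {S : Type*} [Semigroup S] [TopologicalSpace S] [T2Space S]

/-- A compact subsemigroup `C` of a right topological semigroup contains an idempotent `u` that is
minimal for the usual order on the idempotents of `C`. -/
theorem exists_minimal_idempotent (hc : ∀ r : S, Continuous (· * r)) (C : Set S)
    (hne : C.Nonempty) (hC : IsCompact C) (hmul : ∀ x ∈ C, ∀ y ∈ C, x * y ∈ C) :
    ∃ u ∈ C, u * u = u ∧ ∀ f ∈ C, f * f = f → f * u = f → u * f = f → f = u := by
  let 𝓘 : Set (Set S) := {L | L ⊆ C ∧ IsClosed L ∧ L.Nonempty ∧ ∀ x ∈ C, ∀ y ∈ L, x * y ∈ L}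
  obtain ⟨L, -, hL⟩ : ∃ L, L ⊆ C ∧ Minimal (· ∈ 𝓘) L := by
    refine zorn_superset_nonempty 𝓘 (fun c hc𝓘 hchain hcne => ?_) C
      ⟨subset_rfl, hC.isClosed, hne, hmul⟩
    refine ⟨⋂₀ c, ⟨?_, ?_, ?_, ?_⟩, fun s hs => Set.sInter_subset_of_mem hs⟩
    · obtain ⟨s, hs⟩ := hcne
      exact (Set.sInter_subset_of_mem hs).trans (hc𝓘 hs).1
    · exact isClosed_sInter fun s hs => (hc𝓘 hs).2.1
    · exact (IsCompact.nonempty_sInter_of_directed_nonempty_isCompact_isClosed (hS := hcne.to_subtype))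
        (fun s hs t ht => (hchain.total hs ht).elim (fun h => ⟨s, hs, subset_rfl, h⟩)
          fun h => ⟨t, ht, h, subset_rfl⟩)
        (fun s hs => (hc𝓘 hs).2.2.1)
        (fun s hs => hC.of_isClosed_subset (hc𝓘 hs).2.1 (hc𝓘 hs).1)
        (fun s hs => (hc𝓘 hs).2.1)
    · exact fun x hx y hy s hs => (hc𝓘 hs).2.2.2 x hx y (hy s hs)
  obtain ⟨hLC, hLcl, hLne, hLmul⟩ := hL.prop
  obtain ⟨u, huL, huu⟩ := exists_idempotent_in_compact_subsemigroup hc L hLne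
    (hC.of_isClosed_subset hLcl hLC) (fun x hx y hy => hLmul x (hLC hx) y hy)
  refine ⟨u, hLC huL, huu, fun f hf hff hfu huf => ?_⟩
  -- `C * f` is a closed left ideal inside the minimal `L`, so it equals `L`. Thus `u = t * f` for
  -- some `t`, and `f = u * f = t * f * f = u`.
  have hsub : (· * f) '' C ⊆ L := by
    rintro _ ⟨t, ht, rfl⟩
    have : t * f = t * f * u := by rw [mul_assoc, hfu]
    dsimp only
    rw [this]
    exact hLmul _ (hmul t ht f hf) u huL
  have hmem : (· * f) '' C ∈ 𝓘 := by
    refine ⟨hsub.trans hLC, (hC.image (hc f)).isClosed, hne.image _, ?_⟩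
    rintro x hx _ ⟨t, ht, rfl⟩
    exact ⟨x * t, hmul x hx t ht, mul_assoc _ _ _⟩
  obtain ⟨t, -, ht⟩ := hL.le_of_le hmem hsub huL
  calc f = u * f := huf.symm
    _ = t * f * f := congrArg (· * f) ht.symm
    _ = u := by rw [mul_assoc, hff]; exact ht

/-- Below an idempotent `u` there is an idempotent in every compact subsemigroup `D` that is stable
under multiplication by `u` on both sides. -/
theorem exists_idempotent_le (hc : ∀ r : S, Continuous (· * r)) (D : Set S) (hne : D.Nonempty)
    (hD : IsCompact D) (hmul : ∀ x ∈ D, ∀ y ∈ D, x * y ∈ D) (u : S) (huu : u * u = u)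
    (hDu : ∀ x ∈ D, x * u ∈ D) (huD : ∀ x ∈ D, u * x ∈ D) :
    ∃ v ∈ D, v * v = v ∧ v * u = v ∧ u * v = v := by
  obtain ⟨_, ⟨t, ht, rfl⟩, hee⟩ := exists_idempotent_in_compact_subsemigroup hc ((· * u) '' D)
    (hne.image _) (hD.image (hc u)) (by
      rintro _ ⟨x, hx, rfl⟩ _ ⟨y, hy, rfl⟩
      exact ⟨x * u * y, hmul _ (hDu x hx) y hy, by simp only [mul_assoc]⟩)
  dsimp only at hee
  -- The idempotent `t * u` absorbs `u` on the right only; multiplying by `u` on the left gives both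
  -- sides.
  refine ⟨u * (t * u), huD _ (hDu t ht), ?_, ?_, ?_⟩
  · have : u * (t * u) * (u * (t * u)) = u * (t * (u * u) * (t * u)) := by
      simp only [mul_assoc]
    rw [this, huu, hee]
  · rw [mul_assoc, mul_assoc, huu]
  · rw [← mul_assoc, huu]

end CompactSemigroup

/-! ### Ultrafilters of constant and variable words, and the recursive construction. -/

section Ultrafilters

variable {M ι : Type*}

/-- The ultrafilters that contain every member of the family `C`. -/
def ultrafiltersOn (C : ι → Set M) : Set (Ultrafilter M) := {p | ∀ n, C n ∈ p}

theorem isCompact_ultrafiltersOn (C : ι → Set M) : IsCompact (ultrafiltersOn C) := by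
  have : ultrafiltersOn C = ⋂ n, {p : Ultrafilter M | C n ∈ p} := by
    ext; simp [ultrafiltersOn]
  rw [this]
  exact (isClosed_iInter fun n => ultrafilter_isClosed_basic _).isCompact

theorem map_ultrafilter_eq_self (T : M → M) {s : Set M} {p : Ultrafilter M} (hs : s ∈ p)
    (hT : ∀ z ∈ s, T z = z) : p.map T = p := by
  refine Ultrafilter.coe_inj.mp ?_
  rw [Ultrafilter.coe_map]
  have : (T : M → M) =ᶠ[(p : Filter M)] id := by
    filter_upwards [hs] with z hz using hT z hz
  rw [Filter.map_congr this, Filter.map_id]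

theorem ultrafiltersOn_nonempty {V : ℕ+ → Set M} (hV : Antitone V) (hne : ∀ n, (V n).Nonempty) :
    (ultrafiltersOn V).Nonempty := by
  choose v hv using hne
  refine ⟨Ultrafilter.of (Filter.map v Filter.atTop), fun n => ?_⟩
  refine Ultrafilter.of_le _ (Filter.mem_map.2 ?_)
  filter_upwards [Filter.eventually_ge_atTop n] with m hm using hV hm (hv m)

variable [Semigroup M]

/-- A set is `p * q`-large when, for `p`-most `z`, it contains `z * y` for `q`-most `y`. So `m` may
depend on `z`: products need only behave well when the right factor is far out. -/
theorem mul_mem_ultrafiltersOn {C D G : ι → Set M}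
    (h : ∀ n, ∀ z ∈ C n, ∃ m, ∀ y ∈ D m, z * y ∈ G n) {p q : Ultrafilter M}
    (hp : p ∈ ultrafiltersOn C) (hq : q ∈ ultrafiltersOn D) : p * q ∈ ultrafiltersOn G := by
  intro n
  refine (Ultrafilter.eventually_mul p q (· ∈ G n)).2 ?_
  filter_upwards [hp n] with z hz
  obtain ⟨m, hm⟩ := h n z hz
  filter_upwards [hq m] with y hy using hm y hy

theorem map_mul_ultrafilter (T : M →ₙ* M) (p q : Ultrafilter M) :
    (p * q).map T = p.map T * q.map T := by
  refine Ultrafilter.coe_inj.mp (Filter.ext' fun P => ?_)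
  simp only [Ultrafilter.coe_map, Filter.eventually_map, Ultrafilter.eventually_mul, map_mul]

/-- There are an idempotent ultrafilter `U` of constant words and an ultrafilter `V` of variable
words such that every substitution maps `V` to `U`. -/
theorem exists_ultrafilter_map_eq {P : Type*} (C V : ℕ+ → Set M) (T : P → M →ₙ* M)
    (F : ℕ+ → Finset P) (hF : Monotone F) (hFne : (F 1).Nonempty)
    (hV : Antitone V) (hC : Antitone C) (hVne : ∀ n, (V n).Nonempty)
    (hCC : ∀ n, ∀ z ∈ C n, ∃ m, ∀ y ∈ C m, z * y ∈ C n)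
    (hCV : ∀ n, ∀ z ∈ C n, ∃ m, ∀ y ∈ V m, z * y ∈ V n)
    (hVC : ∀ n, ∀ z ∈ V n, ∃ m, ∀ y ∈ C m, z * y ∈ V n)
    (hVV : ∀ n, ∀ z ∈ V n, ∃ m, ∀ y ∈ V m, z * y ∈ V n)
    (hTC : ∀ b, ∀ z ∈ C 1, T b z = z)
    (hTV : ∀ n, ∀ b ∈ F n, ∀ z ∈ V n, T b z ∈ C n) :
    ∃ U p : Ultrafilter M, U * U = U ∧ p ∈ ultrafiltersOn V ∧
      ∀ n, ∀ b ∈ F n, p.map (T b) = U := by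
  have hmap : ∀ n, ∀ b ∈ F n, ∀ p ∈ ultrafiltersOn V, p.map (T b) ∈ ultrafiltersOn C := by
    intro n b hb p hp m
    rw [Ultrafilter.mem_map]
    filter_upwards [hp (max n m)] with z hz
    -- The letter `b ∈ F n` is admissible only from level `n` on, which costs nothing because `p`
    -- contains every `V m`.
    exact hC (le_max_right n m) (hTV _ b (hF (le_max_left n m) hb) z hz)
  have hVne' := ultrafiltersOn_nonempty hV hVne
  have hCne' : (ultrafiltersOn C).Nonempty := by
    obtain ⟨b, hb⟩ := hFne
    obtain ⟨p, hp⟩ := hVne'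
    exact ⟨_, hmap 1 b hb p hp⟩
  obtain ⟨U, hUC, hUU, hmin⟩ := exists_minimal_idempotent Ultrafilter.continuous_mul_left _ hCne'
    (isCompact_ultrafiltersOn C) (fun _ hx _ hy => mul_mem_ultrafiltersOn hCC hx hy)
  obtain ⟨p, hp, hpp, hpU, hUp⟩ := exists_idempotent_le Ultrafilter.continuous_mul_left
    (ultrafiltersOn V) hVne' (isCompact_ultrafiltersOn V)
    (fun _ hx _ hy => mul_mem_ultrafiltersOn hVV hx hy) U hUU
    (fun _ hx => mul_mem_ultrafiltersOn hVC hx hUC)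
    (fun _ hx => mul_mem_ultrafiltersOn hCV hUC hx)
  refine ⟨U, p, hUU, hp, fun n b hb => hmin _ (hmap n b hb p hp) ?_ ?_ ?_⟩
  · rw [← map_mul_ultrafilter, hpp]
  · nth_rewrite 1 [← map_ultrafilter_eq_self (T b) (hUC 1) (hTC b)]
    rw [← map_mul_ultrafilter, hpU]
  · nth_rewrite 1 [← map_ultrafilter_eq_self (T b) (hUC 1) (hTC b)]
    rw [← map_mul_ultrafilter, hUp]

/-- A sequence of variable words all of whose products of substituted terms, taken in increasing
order, lie in the set of the family `O` given by the index of the first factor. -/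
theorem exists_seq_foldl_mem {P : Type*} {U p : Ultrafilter M} (hUU : U * U = U)
    (V : ℕ+ → Set M) (hp : p ∈ ultrafiltersOn V) (T : P → M → M) (F : ℕ+ → Finset P)
    (hT : ∀ n, ∀ b ∈ F n, p.map (T b) = U) (O : ℕ+ → Set M) (hO : ∀ n, O n ∈ U) (g : M → ℕ+) :
    ∃ u : ℕ+ → M, (∀ n, u n ∈ V n) ∧ (∀ n, u (n + 1) ∈ V (g (u n))) ∧
      ∀ (l : List ℕ+) (n : ℕ+) (s : ℕ+ → P), (n :: l).Pairwise (· < ·) →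
        (∀ m ∈ n :: l, s m ∈ F m) →
        (l.map fun m => T (s m) (u m)).foldl (· * ·) (T (s n) (u n)) ∈ O n := by
  have hpick : ∀ (B : {B : Set M // B ∈ U}) (n k : ℕ+), ∃ v, v ∈ V n ∧ v ∈ V k ∧
      ∀ b ∈ F n, T b v ∈ B.1 ∧ {y | T b v * y ∈ B.1} ∈ U := by
    rintro ⟨B, hB⟩ n k
    -- The Galvin–Glazer step, from `U * U = U`. It pulls back to `p` along each of the finitely
    -- many substitutions in `F n`.
    have hB' : {z | z ∈ B ∧ {y | z * y ∈ B} ∈ U} ∈ U := by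
      have : ∀ᶠ z in ((U * U : Ultrafilter M) : Filter M), z ∈ B := by rw [hUU]; exact hB
      filter_upwards [hB, (Ultrafilter.eventually_mul U U (· ∈ B)).1 this] with z h1 h2
        using ⟨h1, h2⟩
    have hall : ∀ᶠ v in (p : Filter M), ∀ b ∈ F n, T b v ∈ B ∧ {y | T b v * y ∈ B} ∈ U := by
      rw [Filter.eventually_all_finset]
      intro b hb
      rw [← hT n b hb] at hB'
      rw [← hT n b hb]
      exact Ultrafilter.mem_map.1 hB'
    obtain ⟨v, hv⟩ := (hall.and ((Filter.eventually_mem_set.2 (hp n)).and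
      (Filter.eventually_mem_set.2 (hp k)))).exists
    exact ⟨v, hv.2.1, hv.2.2, hv.1⟩
  choose pick hpV hpk hpF using hpick
  -- The state holds a `U`-large set in which all later products must lie, and a level beyond which
  -- the next word is chosen. Finiteness of `F n` keeps the intersection `U`-large.
  let next : ℕ+ → {B : Set M // B ∈ U} × ℕ+ → {B : Set M // B ∈ U} × ℕ+ := fun n σ =>
    (⟨σ.1.1 ∩ O (n + 1) ∩ ⋂ b ∈ F n, {y | T b (pick σ.1 n σ.2) * y ∈ σ.1.1},
      Filter.inter_mem (Filter.inter_mem σ.1.2 (hO _))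
        ((Filter.biInter_finset_mem _).2 fun b hb => (hpF σ.1 n σ.2 b hb).2)⟩,
      g (pick σ.1 n σ.2))
  let σ : ℕ+ → {B : Set M // B ∈ U} × ℕ+ := fun n => PNat.recOn n (⟨O 1, hO 1⟩, 1) next
  have hσ : ∀ n, σ (n + 1) = next n (σ n) := fun n => PNat.recOn_succ n _ _
  let u : ℕ+ → M := fun n => pick (σ n).1 n (σ n).2
  have hanti : Antitone fun n => (σ n).1.1 := by
    intro a b
    refine PNat.recOn b (fun h => ?_) fun n ih h => ?_
    · rw [le_one_iff_eq_one.1 h]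
    · rcases h.lt_or_eq with h | h
      · refine le_trans ?_ (ih (PNat.lt_add_one_iff.1 h))
        dsimp only
        rw [hσ]
        exact fun y hy => hy.1.1
      · rw [h]
  have hsubO : ∀ n, (σ n).1.1 ⊆ O n := by
    intro n
    refine PNat.recOn n (subset_refl _) fun n _ => ?_
    rw [hσ]
    exact fun y hy => hy.1.2
  refine ⟨u, fun n => hpV _ _ _, fun n => ?_, fun l n s hl hs => hsubO n ?_⟩
  · have h : (σ (n + 1)).2 = g (u n) := by rw [hσ]
    exact h ▸ hpk (σ (n + 1)).1 (n + 1) (σ (n + 1)).2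
  · induction l generalizing n with
    | nil => exact (hpF _ _ _ _ (hs n (by simp))).1
    | cons m l ih =>
      have h := ih m (List.pairwise_cons.1 hl).2 fun i hi => hs i (List.mem_cons_of_mem _ hi)
      have hnm : n + 1 ≤ m := PNat.add_one_le_iff.2 ((List.pairwise_cons.1 hl).1 m (by simp))
      -- The tail product lies in the state set at `m`, hence in the one at `n + 1`, which was built
      -- to bring it back into the set at `n` after multiplication by the head.
      have h' := hanti hnm h
      simp only [hσ, next] at h'
      have h'' := Set.mem_iInter₂.1 h'.2 (s n) (hs n (by simp))
      simp only [List.map_cons, List.foldl_cons]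
      rw [List.foldl_assoc]
      exact h''

end Ultrafilters
end LocWord

namespace LocWord

/-! ### Located words as a semigroup, extracted words, and the abstract limit theorem. -/

section Words

variable {A P : Type*}

theorem ext_letter {w u : LocWord A} (h : ∀ n, w.letter n = u.letter n) : w = u := by
  refine LocWord.ext (funext h) (Finset.ext fun n => ?_)
  rw [w.mem_dom, u.mem_dom, h]

theorem star_letter (w u : LocWord A) (n : ℤ) :
    (star w u).letter n = (w.letter n).or (u.letter n) := rfl

theorem mem_dom_star {w u : LocWord A} {n : ℤ} : n ∈ (star w u).dom ↔ n ∈ w.dom ∨ n ∈ u.dom :=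
  Finset.mem_union

theorem mem_dom_of_letter {w : LocWord A} {n : ℤ} {a : A} (h : w.letter n = some a) :
    n ∈ w.dom := (w.mem_dom n).2 (by rw [h]; exact Option.some_ne_none a)

theorem letter_eq_none {w : LocWord A} {n : ℤ} (h : n ∉ w.dom) : w.letter n = none :=
  not_not.1 fun h' => h ((w.mem_dom n).2 h')

/-- Left precedence makes `⋆` total and still associative, so no partial semigroup is needed. -/
instance starSemigroup : Semigroup (LocWord A) where
  mul := star
  mul_assoc _ _ _ := ext_letter fun _ => Option.or_assoc ..

theorem replaceVar_letter (υ : A) (f : ℤ → A) (w : LocWord A) (n : ℤ) [DecidableEq A] :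
    (replaceVar υ f w).letter n = (w.letter n).map fun a => if a = υ then f n else a := by
  simp only [replaceVar]
  congr!

/-- Replacing the variable, as an endomorphism of the semigroup of located words. -/
noncomputable def replaceHom (υ : A) (f : ℤ → A) : LocWord A →ₙ* LocWord A where
  toFun := replaceVar υ f
  map_mul' w u := ext_letter fun n => by
    classical
    change (replaceVar υ f (star w u)).letter n = ((replaceVar υ f w).letter n).or _
    simp only [replaceVar_letter, star_letter]
    cases w.letter n <;> rfl

/-- Replacing the variable by a letter of `P`, or leaving the word unchanged (`none`). -/
noncomputable def replaceOpt (υ : A) (f : P → ℤ → A) (w : LocWord A) : Option P → LocWord A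
  | none => w
  | some b => replaceVar υ (f b) w

theorem dom_replaceOpt (υ : A) (f : P → ℤ → A) (w : LocWord A) (o : Option P) :
    (replaceOpt υ f w o).dom = w.dom := by
  cases o <;> rfl

theorem mem_dom_concat {w : LocWord A} {l : List (LocWord A)} {j : ℤ} :
    j ∈ (concat w l).dom ↔ ∃ v ∈ w :: l, j ∈ v.dom := by
  induction l generalizing w with
  | nil => simp [concat]
  | cons v l ih =>
    have : concat w (v :: l) = concat (star w v) l := rfl
    rw [this, ih]
    simp [mem_dom_star, or_assoc]

theorem concat_append (w v : LocWord A) (l l' : List (LocWord A)) :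
    concat w (l ++ v :: l') = concat w l * concat v l' := by
  have h : ∀ (l : List (LocWord A)) (x y : LocWord A),
      (l.foldl star (star x y) : LocWord A) = star x (l.foldl star y) := by
    intro l
    induction l with
    | nil => exact fun _ _ => rfl
    | cons z l ih =>
      intro x y
      simp only [List.foldl_cons]
      rw [← ih]
      exact congrArg (List.foldl star · l) (mul_assoc x y z)
  simp only [concat, List.foldl_append, List.foldl_cons]
  exact h _ _ _

theorem replaceVar_concat (υ : A) (f : ℤ → A) (w : LocWord A) (l : List (LocWord A)) :
    replaceVar υ f (concat w l) = concat (replaceVar υ f w) (l.map (replaceVar υ f)) := by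
  induction l generalizing w with
  | nil => rfl
  | cons v l ih =>
    change replaceVar υ f (concat (star w v) l) = concat (star _ _) _
    rw [ih]
    exact congrArg (concat · _) ((replaceHom υ f).map_mul w v)

/-- Constant words `K` and variable words `W` over letters in `P`, where `b : P` is substituted
for the variable at position `j` as `f b j`, and `F n` is the set of letters that may be
substituted at distance at least `n` from the origin. -/
structure IsSubstitutionSystem (υ : A) (f : P → ℤ → A) (F : ℕ+ → Finset P)
    (K W : Set (LocWord A)) : Prop where
  mono : Monotone F
  nonempty : (F 1).Nonempty
  const_mul_const : ∀ z ∈ K, ∀ y ∈ K, z * y ∈ K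
  var_mul_const : ∀ z ∈ W, ∀ y ∈ K, z * y ∈ W
  var_mul_var : ∀ z ∈ W, ∀ y ∈ W, z * y ∈ W
  const_mul_var : ∀ z ∈ K, ∀ y ∈ W, Disjoint z.dom y.dom → z * y ∈ W
  replaceVar_const : ∀ b, ∀ z ∈ K, replaceVar υ (f b) z = z
  replaceVar_var : ∀ (n : ℕ+), ∀ b ∈ F n, ∀ z ∈ W, (∀ j ∈ z.dom, (n : ℤ) ≤ |j|) →
    replaceVar υ (f b) z ∈ K

/-- `z` is a concatenation of substituted terms of `w` with indices at least `N`. The proposition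
`c` says whether the variable has been replaced in each of these terms. -/
def IsExtracted (υ : A) (f : P → ℤ → A) (F : ℕ+ → Finset P) (w : ℕ+ → LocWord A) (N : ℕ+)
    (c : Prop) (z : LocWord A) : Prop :=
  ∃ (n : ℕ+) (l : List ℕ+) (s : ℕ+ → Option P), (n :: l).Pairwise (· < ·) ∧
    (∀ m ∈ n :: l, N ≤ m) ∧ (∀ m ∈ n :: l, ∀ b, s m = some b → b ∈ F m) ∧
    (c ↔ ∀ m ∈ n :: l, s m ≠ none) ∧
    z = concat (replaceOpt υ f (w n) (s n)) (l.map fun m => replaceOpt υ f (w m) (s m))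

variable {υ : A} {f : P → ℤ → A} {F : ℕ+ → Finset P} {w : ℕ+ → LocWord A}

theorem IsExtracted.anti {N M : ℕ+} (h : N ≤ M) {c : Prop} {z : LocWord A}
    (hz : IsExtracted υ f F w M c z) : IsExtracted υ f F w N c z := by
  obtain ⟨n, l, s, h1, h2, h3⟩ := hz
  exact ⟨n, l, s, h1, fun m hm => h.trans (h2 m hm), h3⟩

theorem IsExtracted.le_abs {N : ℕ+} {c : Prop} {z : LocWord A} (hz : IsExtracted υ f F w N c z)
    (hw : ∀ n : ℕ+, ∀ j ∈ (w n).dom, (n : ℤ) ≤ |j|) : ∀ j ∈ z.dom, (N : ℤ) ≤ |j| := by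
  obtain ⟨n, l, s, -, h2, -, -, rfl⟩ := hz
  intro j hj
  obtain ⟨v, hv, hjv⟩ := mem_dom_concat.1 hj
  obtain ⟨m, hm, rfl⟩ : ∃ m ∈ n :: l, replaceOpt υ f (w m) (s m) = v := by
    simpa [@eq_comm _ v] using hv
  rw [dom_replaceOpt] at hjv
  exact le_trans (by exact_mod_cast h2 m hm) (hw m j hjv)

/-- With `M` above every index used in `z`, the two index lists concatenate to an increasing one,
and the substitutions glue. The product is constant exactly when both factors are. -/
theorem IsExtracted.mul {N : ℕ+} {c : Prop} {z : LocWord A} (hz : IsExtracted υ f F w N c z) :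
    ∃ M, ∀ (c' : Prop) (y : LocWord A), IsExtracted υ f F w M c' y →
      IsExtracted υ f F w N (c ∧ c') (z * y) := by
  classical
  obtain ⟨n, l, s, h1, h2, h3, h4, rfl⟩ := hz
  obtain ⟨M, hM⟩ : ∃ M, ∀ m ∈ n :: l, m < M := by
    obtain ⟨M, hM⟩ := (n :: l).toFinset.bddAbove
    exact ⟨M + 1, fun m hm => PNat.lt_add_one_iff.2 (hM (by simpa using hm))⟩
  refine ⟨M, ?_⟩
  rintro c' _ ⟨n', l', s', h1', h2', h3', h4', rfl⟩
  have hlt : ∀ m ∈ n :: l, ∀ m' ∈ n' :: l', m < m' := fun m hm m' hm' =>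
    (hM m hm).trans_le (h2' m' hm')
  let t : ℕ+ → Option P := fun m => if m ∈ n :: l then s m else s' m
  have ht : ∀ m ∈ n :: l, t m = s m := fun m hm => if_pos hm
  have ht' : ∀ m ∈ n' :: l', t m = s' m := fun m hm =>
    if_neg fun h => (hlt m h m hm).false
  have hmem : ∀ m, m ∈ n :: (l ++ n' :: l') ↔ m ∈ n :: l ∨ m ∈ n' :: l' := fun m => by
    rw [← List.cons_append, List.mem_append]
  have hn : N ≤ M := (h2 n (by simp)).trans (hM n (by simp)).le
  refine ⟨n, l ++ n' :: l', t, ?_, ?_, ?_, ?_, ?_⟩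
  · rw [← List.cons_append, List.pairwise_append]
    exact ⟨h1, h1', hlt⟩
  · intro m hm
    exact ((hmem m).1 hm).elim (h2 m) fun h => hn.trans (h2' m h)
  · intro m hm
    rcases (hmem m).1 hm with h | h
    · rw [ht m h]; exact h3 m h
    · rw [ht' m h]; exact h3' m h
  · rw [h4, h4']
    constructor
    · intro h m hm
      rcases (hmem m).1 hm with h' | h'
      · rw [ht m h']; exact h.1 m h'
      · rw [ht' m h']; exact h.2 m h'
    · intro h
      exact ⟨fun m hm => ht m hm ▸ h m ((hmem m).2 (Or.inl hm)),
        fun m hm => ht' m hm ▸ h m ((hmem m).2 (Or.inr hm))⟩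
  · rw [List.map_append, List.map_cons, concat_append, ht n (by simp), ht' n' (by simp)]
    congr 2
    · exact List.map_congr_left fun m hm => by rw [ht m (List.mem_cons_of_mem _ hm)]
    · exact List.map_congr_left fun m hm => by rw [ht' m (List.mem_cons_of_mem _ hm)]

variable {K W : Set (LocWord A)}

/-- Terms already substituted are constant and stay fixed; the others receive `b`, admissible there
since `F` is monotone and their indices are at least `N`. -/
theorem IsExtracted.replaceVar (hS : IsSubstitutionSystem υ f F K W)
    (hwW : ∀ n, w n ∈ W) (hw : ∀ n : ℕ+, ∀ j ∈ (w n).dom, (n : ℤ) ≤ |j|)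
    {N : ℕ+} {c : Prop} {z : LocWord A} (hz : IsExtracted υ f F w N c z) {b : P} (hb : b ∈ F N) :
    IsExtracted υ f F w N True (replaceVar υ (f b) z) := by
  obtain ⟨n, l, s, h1, h2, h3, -, rfl⟩ := hz
  have key : ∀ m ∈ n :: l, LocWord.replaceVar υ (f b) (replaceOpt υ f (w m) (s m)) =
      replaceOpt υ f (w m) (some ((s m).getD b)) := by
    intro m hm
    cases hs : s m with
    | none => rfl
    | some d =>
      exact hS.replaceVar_const b _ (hS.replaceVar_var m d (h3 m hm d hs) _ (hwW m) (hw m))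
  refine ⟨n, l, fun m => some ((s m).getD b), h1, h2, ?_, by simp, ?_⟩
  · rintro m hm d hd
    rw [← Option.some.inj hd]
    cases hs : s m with
    | none => exact hS.mono (h2 m hm) hb
    | some d => exact h3 m hm d hs
  · rw [replaceVar_concat, key n (by simp), List.map_map]
    congr 1
    exact List.map_congr_left fun m hm => key m (List.mem_cons_of_mem _ hm)

theorem exists_abs_lt_of_mem_dom (z : LocWord A) : ∃ N : ℕ+, ∀ j ∈ z.dom, |j| < (N : ℤ) := by
  obtain ⟨B, hB⟩ := (z.dom.image fun j => j.natAbs).bddAbove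
  refine ⟨B.succPNat, fun j hj => ?_⟩
  have := hB (Finset.mem_coe.2 (Finset.mem_image_of_mem _ hj))
  simp only [Nat.succPNat_coe, Nat.succ_eq_add_one, Nat.cast_add, Nat.cast_one]
  rw [Int.abs_eq_natAbs]
  lia

/-- The limit theorem for an arbitrary system of substitutions. -/
theorem IsSubstitutionSystem.exists_extraction (hS : IsSubstitutionSystem υ f F K W)
    {X : Type*} [MetricSpace X] [CompactSpace X] (x : LocWord A → X)
    (hwW : ∀ n, w n ∈ W) (hw : ∀ n : ℕ+, ∀ j ∈ (w n).dom, (n : ℤ) ≤ |j|) :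
    ∃ u : ℕ+ → LocWord A, (∀ n, u n ∈ W ∧ IsExtracted υ f F w 1 False (u n)) ∧
      (∀ n, ∀ i ∈ (u n).dom, ∀ j ∈ (u (n + 1)).dom, |i| < |j|) ∧
      ∃ x₀ : X, ∀ O ∈ 𝓝 x₀, ∃ N : ℕ, ∀ (n : ℕ+) (l : List ℕ+) (s : ℕ+ → P),
        (n :: l).Pairwise (· < ·) → (∀ m ∈ n :: l, s m ∈ F m) →
        (∀ j ∈ (concat (replaceVar υ (f (s n)) (u n))
          (l.map fun m => replaceVar υ (f (s m)) (u m))).dom, (N : ℤ) ≤ |j|) →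
        x (concat (replaceVar υ (f (s n)) (u n))
          (l.map fun m => replaceVar υ (f (s m)) (u m))) ∈ O := by
  let C : ℕ+ → Set (LocWord A) := fun N => {z | z ∈ K ∧ IsExtracted υ f F w N True z}
  let V : ℕ+ → Set (LocWord A) := fun N => {z | z ∈ W ∧ IsExtracted υ f F w N False z}
  obtain ⟨U, p, hUU, hp, hpU⟩ : ∃ U p : Ultrafilter (LocWord A), U * U = U ∧
      p ∈ ultrafiltersOn V ∧ ∀ n, ∀ b ∈ F n, p.map (replaceHom υ (f b)) = U := by
    refine exists_ultrafilter_map_eq C V (fun b => replaceHom υ (f b)) F hS.mono hS.nonempty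
      (fun a b h z hz => ⟨hz.1, hz.2.anti h⟩) (fun a b h z hz => ⟨hz.1, hz.2.anti h⟩)
      (fun n => ⟨w n, hwW n, n, [], fun _ => none, by simp, by simp, by simp, by simp, rfl⟩)
      ?_ ?_ ?_ ?_ (fun b z hz => hS.replaceVar_const b z hz.1)
      (fun n b hb z hz => ⟨hS.replaceVar_var n b hb z hz.1 (hz.2.le_abs hw),
        hz.2.replaceVar hS hwW hw hb⟩)
    · rintro n z ⟨hz, hz'⟩
      obtain ⟨M, hM⟩ := hz'.mul
      exact ⟨M, fun y hy => ⟨hS.const_mul_const z hz y hy.1, by simpa using hM _ y hy.2⟩⟩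
    · rintro n z ⟨hz, hz'⟩
      obtain ⟨M, hM⟩ := hz'.mul
      obtain ⟨B, hB⟩ := exists_abs_lt_of_mem_dom z
      refine ⟨max M B, fun y hy => ⟨hS.const_mul_var z hz y hy.1 ?_,
        by simpa using hM _ y (hy.2.anti (le_max_left _ _))⟩⟩
      -- Beyond level `B` the domain of `y` avoids that of `z`, so no variable of `y` is
      -- overwritten.
      rw [Finset.disjoint_left]
      exact fun j hj hj' =>
        ((hB j hj).trans_le ((hy.2.anti (le_max_right _ _)).le_abs hw j hj')).false
    · rintro n z ⟨hz, hz'⟩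
      obtain ⟨M, hM⟩ := hz'.mul
      exact ⟨M, fun y hy => ⟨hS.var_mul_const z hz y hy.1, by simpa using hM _ y hy.2⟩⟩
    · rintro n z ⟨hz, hz'⟩
      obtain ⟨M, hM⟩ := hz'.mul
      exact ⟨M, fun y hy => ⟨hS.var_mul_var z hz y hy.1, by simpa using hM _ y hy.2⟩⟩
  obtain ⟨x₀, hx₀⟩ : ∃ x₀, Filter.Tendsto x U (𝓝 x₀) := by
    obtain ⟨x₀, -, h⟩ := isCompact_univ.ultrafilter_le_nhds (U.map x) (by simp)
    exact ⟨x₀, h⟩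
  obtain ⟨Bs, hBs⟩ := (𝓝 x₀).exists_antitone_basis
  choose g hg using exists_abs_lt_of_mem_dom (A := A)
  obtain ⟨u, huV, hug, hu⟩ := exists_seq_foldl_mem hUU V hp
    (fun b => replaceHom υ (f b)) F hpU (fun n => x ⁻¹' Bs n)
    (fun n => hx₀ (hBs.1.mem_of_mem trivial)) g
  refine ⟨u, fun n => ⟨(huV n).1, (huV n).2.anti one_le⟩, fun n i hi j hj =>
    (hg (u n) i hi).trans_le ((hug n).2.le_abs hw j hj), x₀, fun O hO => ?_⟩
  obtain ⟨n₀, -, hn₀⟩ := hBs.1.mem_iff.1 hO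
  let n₁ : ℕ+ := n₀.succPNat
  -- The sum is a crude common bound for the domains of all `u m` with `m < n₁`; a word beyond it
  -- cannot start with such a term.
  refine ⟨∑ m ∈ Finset.Iio n₁, (g (u m) : ℕ), fun n l s hl hs hN => hn₀ ?_⟩
  have hn : n₁ ≤ n := by
    by_contra! h
    obtain ⟨j, hj⟩ := (u n).nonempty
    have h1 := hN j (mem_dom_concat.2 ⟨_, List.mem_cons_self, hj⟩)
    have h2 := Finset.single_le_sum (f := fun m => (g (u m) : ℕ)) (fun _ _ => Nat.zero_le _)
      (Finset.mem_Iio.2 h)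
    have h3 := hg (u n) j hj
    have h4 : ((g (u n) : ℕ) : ℤ) ≤ ((∑ m ∈ Finset.Iio n₁, (g (u m) : ℕ) : ℕ) : ℤ) :=
      Int.ofNat_le.2 h2
    lia
  have hle : n₀ ≤ n := (Nat.le_succ n₀).trans (PNat.coe_le_coe _ _ |>.2 hn)
  exact hBs.2 hle (hu l n s hl hs)

end Words
end LocWord

namespace LocWord

/-! ### The two-sided and the positive substitution systems. -/

section Instances

variable {A : Type*} {α : ℤ → A} {k : ℤ → ℕ} {υ : A}

theorem letter_mul {z y : LocWord A} {n : ℤ} {a : A} (h : (z * y).letter n = some a) :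
    z.letter n = some a ∨ y.letter n = some a := by
  change (z.letter n).or (y.letter n) = some a at h
  cases hz : z.letter n with
  | none => rw [hz] at h; exact Or.inr h
  | some b => rw [hz] at h; exact Or.inl h

theorem letter_mul_left {z : LocWord A} (y : LocWord A) {n : ℤ} {a : A}
    (h : z.letter n = some a) : (z * y).letter n = some a := by
  change (z.letter n).or (y.letter n) = some a
  rw [h]
  rfl

theorem letter_mul_right {z y : LocWord A} (hd : Disjoint z.dom y.dom) {n : ℤ} {a : A}
    (h : y.letter n = some a) : (z * y).letter n = some a := by
  change (z.letter n).or (y.letter n) = some a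
  rw [letter_eq_none fun h' => Finset.disjoint_left.1 hd h' (mem_dom_of_letter h), h]
  rfl

theorem ne_of_mem_allowed (hυ : ∀ n : ℤ, n ≠ 0 → α n ≠ υ) {n : ℤ} {a : A}
    (h : a ∈ allowed α k n) : a ≠ υ := by
  obtain ⟨i, hi, rfl⟩ := h
  exact hυ i (by lia)

theorem replaceVar_eq_self (hυ : ∀ n : ℤ, n ≠ 0 → α n ≠ υ) (f : ℤ → A) {z : LocWord A}
    (hz : z ∈ Ltilde α k) : replaceVar υ f z = z := by
  classical
  refine ext_letter fun n => ?_
  rw [replaceVar_letter]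
  cases h : z.letter n with
  | none => rfl
  | some a => simp [ne_of_mem_allowed hυ (hz n a h)]

theorem replaceVar_mem_Ltilde {f : ℤ → A} {z : LocWord A}
    (hz : ∀ n a, z.letter n = some a → a = υ ∨ a ∈ allowed α k n)
    (hf : ∀ n ∈ z.dom, f n ∈ allowed α k n) : replaceVar υ f z ∈ Ltilde α k := by
  classical
  intro n a h
  rw [replaceVar_letter] at h
  obtain ⟨c, hc, rfl⟩ := Option.map_eq_some_iff.1 h
  split_ifs with hcυ
  · exact hf n (mem_dom_of_letter hc)
  · exact (hz n c hc).resolve_left hcυ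

theorem mem_LtildeVar₀_iff {z : LocWord A} : z ∈ LtildeVar₀ α k υ ↔
    (∀ n a, z.letter n = some a → a = υ ∨ a ∈ allowed α k n) ∧
      (∃ n < 0, z.letter n = some υ) ∧ ∃ n > 0, z.letter n = some υ := by
  constructor
  · rintro ⟨h, ⟨i, hi, hi'⟩, j, hj, hj'⟩
    exact ⟨h.1, ⟨i, (Finset.mem_filter.1 hi).2, hi'⟩, j, (Finset.mem_filter.1 hj).2, hj'⟩
  · rintro ⟨h, ⟨i, hi, hi'⟩, j, hj, hj'⟩
    exact ⟨⟨h, i, hi'⟩, ⟨i, Finset.mem_filter.2 ⟨mem_dom_of_letter hi', hi⟩, hi'⟩,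
      j, Finset.mem_filter.2 ⟨mem_dom_of_letter hj', hj⟩, hj'⟩

/-- The letter that `w(p, q)` puts in place of the variable. -/
def pairLetter (α : ℤ → A) (b : ℕ × ℕ) (n : ℤ) : A :=
  if 0 < n then α (b.1 : ℤ) else α (-(b.2 : ℤ))

/-- The pairs `(p, q)` that may be substituted in the `n`-th term of a sequence. -/
def pairs (k : ℤ → ℕ) (n : ℕ+) : Finset (ℕ × ℕ) :=
  Finset.Icc 1 (k (n : ℤ)) ×ˢ Finset.Icc 1 (k (-(n : ℤ)))

theorem mem_pairs {n : ℕ+} {b : ℕ × ℕ} : b ∈ pairs k n ↔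
    1 ≤ b.1 ∧ b.1 ≤ k (n : ℤ) ∧ 1 ≤ b.2 ∧ b.2 ≤ k (-(n : ℤ)) := by
  simp [pairs, and_assoc]

theorem replaceOpt_pairLetter (w : LocWord A) (o : Option (ℕ × ℕ)) :
    replaceOpt υ (pairLetter α) w o = substTilde α υ w o := by
  cases o <;> rfl

theorem isSubstitutionSystem_tilde (hk : ∀ n : ℤ, n ≠ 0 → 1 ≤ k n)
    (hk_pos : ∀ m n : ℤ, 0 < m → m ≤ n → k m ≤ k n)
    (hk_neg : ∀ m n : ℤ, 0 < m → m ≤ n → k (-m) ≤ k (-n))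
    (hυ : ∀ n : ℤ, n ≠ 0 → α n ≠ υ) :
    IsSubstitutionSystem υ (pairLetter α) (pairs k) (Ltilde α k) (LtildeVar₀ α k υ) where
  mono m n h b hb := by
    rw [mem_pairs] at hb ⊢
    have hm : (0 : ℤ) < m := by exact_mod_cast m.pos
    have hmn : (m : ℤ) ≤ n := by exact_mod_cast h
    exact ⟨hb.1, hb.2.1.trans (hk_pos _ _ hm hmn), hb.2.2.1, hb.2.2.2.trans (hk_neg _ _ hm hmn)⟩
  nonempty := ⟨(1, 1), mem_pairs.2
    ⟨le_rfl, hk _ (by simp), le_rfl, hk _ (by simp)⟩⟩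
  const_mul_const z hz y hy n a h := (letter_mul h).elim (hz n a) (hy n a)
  var_mul_const z hz y hy := by
    rw [mem_LtildeVar₀_iff] at hz ⊢
    obtain ⟨hz, ⟨i, hi, hi'⟩, j, hj, hj'⟩ := hz
    exact ⟨fun n a h => (letter_mul h).elim (hz n a) fun h => Or.inr (hy n a h),
      ⟨i, hi, letter_mul_left _ hi'⟩, j, hj, letter_mul_left _ hj'⟩
  var_mul_var z hz y hy := by
    rw [mem_LtildeVar₀_iff] at hz hy ⊢
    obtain ⟨hz, ⟨i, hi, hi'⟩, j, hj, hj'⟩ := hz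
    exact ⟨fun n a h => (letter_mul h).elim (hz n a) (hy.1 n a),
      ⟨i, hi, letter_mul_left _ hi'⟩, j, hj, letter_mul_left _ hj'⟩
  const_mul_var z hz y hy hd := by
    rw [mem_LtildeVar₀_iff] at hy ⊢
    obtain ⟨hy, ⟨i, hi, hi'⟩, j, hj, hj'⟩ := hy
    exact ⟨fun n a h => (letter_mul h).elim (fun h => Or.inr (hz n a h)) (hy n a),
      ⟨i, hi, letter_mul_right hd hi'⟩, j, hj, letter_mul_right hd hj'⟩
  replaceVar_const b z hz := replaceVar_eq_self hυ _ hz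
  replaceVar_var n b hb z hz hd := by
    refine replaceVar_mem_Ltilde hz.1.1 fun j hj => ?_
    rw [mem_pairs] at hb
    have hn : (0 : ℤ) < n := by exact_mod_cast n.pos
    have hj0 : j ≠ 0 := fun h => z.zero_notMem (h ▸ hj)
    have hnj := hd j hj
    unfold pairLetter
    split_ifs with h
    -- Since `n ≤ |j|`, monotonicity of `k` on each side makes a letter allowed at index `n` allowed
    -- at position `j`.
    · have := hk_pos n j hn (by rwa [abs_of_pos h] at hnj)
      exact ⟨b.1, Or.inl ⟨h, by lia, by lia⟩, rfl⟩
    · have hj' : j < 0 := by lia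
      have := hk_neg n (-j) hn (by rwa [abs_of_neg hj'] at hnj)
      rw [neg_neg] at this
      exact ⟨-b.2, Or.inr ⟨hj', by lia, by lia⟩, rfl⟩

theorem isSubstitutionSystem_pos (hk : ∀ n : ℤ, n ≠ 0 → 1 ≤ k n)
    (hk_pos : ∀ m n : ℤ, 0 < m → m ≤ n → k m ≤ k n)
    (hυ : ∀ n : ℤ, n ≠ 0 → α n ≠ υ) :
    IsSubstitutionSystem υ (fun (p : ℕ) _ => α (p : ℤ))
      (fun n : ℕ+ => Finset.Icc 1 (k (n : ℤ))) (L α k) (LVar α k υ) where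
  mono m n h := Finset.Icc_subset_Icc_right
    (hk_pos _ _ (by exact_mod_cast m.pos) (by exact_mod_cast h))
  nonempty := ⟨1, Finset.mem_Icc.2 ⟨le_rfl, hk _ (by simp)⟩⟩
  const_mul_const z hz y hy := ⟨fun n hn => (mem_dom_star.1 hn).elim (hz.1 n) (hy.1 n),
    fun n a h => (letter_mul h).elim (hz.2 n a) (hy.2 n a)⟩
  var_mul_const z hz y hy := by
    obtain ⟨hz0, hz, i, hi⟩ := hz
    exact ⟨fun n hn => (mem_dom_star.1 hn).elim (hz0 n) (hy.1 n),
      fun n a h => (letter_mul h).elim (hz n a) fun h => Or.inr (hy.2 n a h),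
      i, letter_mul_left _ hi⟩
  var_mul_var z hz y hy := by
    obtain ⟨hz0, hz, i, hi⟩ := hz
    exact ⟨fun n hn => (mem_dom_star.1 hn).elim (hz0 n) (hy.1 n),
      fun n a h => (letter_mul h).elim (hz n a) (hy.2.1 n a), i, letter_mul_left _ hi⟩
  const_mul_var z hz y hy hd := by
    obtain ⟨hy0, hy, i, hi⟩ := hy
    exact ⟨fun n hn => (mem_dom_star.1 hn).elim (hz.1 n) (hy0 n),
      fun n a h => (letter_mul h).elim (fun h => Or.inr (hz.2 n a h)) (hy n a),
      i, letter_mul_right hd hi⟩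
  replaceVar_const b z hz := replaceVar_eq_self hυ _ hz.2
  replaceVar_var n b hb z hz hd := by
    refine ⟨hz.1, replaceVar_mem_Ltilde hz.2.1 fun j hj => ?_⟩
    rw [Finset.mem_Icc] at hb
    have hj0 := hz.1 j hj
    have := hk_pos n j (by exact_mod_cast n.pos) (by simpa [abs_of_pos hj0] using hd j hj)
    exact ⟨b, Or.inl ⟨hj0, by lia, by lia⟩, rfl⟩

theorem replaceOpt_nat (w : LocWord A) (o : Option ℕ) :
    replaceOpt υ (fun (p : ℕ) _ => α (p : ℤ)) w o = subst α υ w o := by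
  cases o <;> rfl

/-- Each `w n` has positions on both sides of `0`, so `R₁` pushes the next domain outwards by at
least one on each side. -/
theorem le_abs_of_mem_LtildeInf {w : ℕ+ → LocWord A} (hw : w ∈ LtildeInf α k υ) (n : ℕ+) :
    ∀ j ∈ (w n).dom, (n : ℤ) ≤ |j| := by
  refine PNat.recOn n (fun j hj => ?_) fun n ih j hj => ?_
  · have hj0 : j ≠ 0 := fun h => (w 1).zero_notMem (h ▸ hj)
    exact Int.one_le_abs hj0
  · obtain ⟨-, ⟨i, hi, hi'⟩, i', hi0, hi0'⟩ := mem_LtildeVar₀_iff.1 (hw.1 n)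
    obtain ⟨A₁, A₂, -, -, hA, h1, h2⟩ := hw.2 n
    rw [hA, Finset.mem_union] at hj
    rw [PNat.add_coe, PNat.one_coe, Nat.cast_add, Nat.cast_one]
    rcases hj with hj | hj
    · have h3 := ih i (mem_dom_of_letter hi')
      have h4 := h1 j hj i (mem_dom_of_letter hi')
      rw [abs_of_neg hi] at h3
      rw [abs_of_neg (h4.trans hi)]
      lia
    · have h3 := ih i' (mem_dom_of_letter hi0')
      have h4 := h2 i' (mem_dom_of_letter hi0') j hj
      rw [abs_of_pos hi0] at h3
      rw [abs_of_pos (lt_trans hi0 h4)]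
      lia

theorem le_abs_of_mem_LInf {w : ℕ+ → LocWord A} (hw : w ∈ LInf α k υ) (n : ℕ+) :
    ∀ j ∈ (w n).dom, (n : ℤ) ≤ |j| := by
  refine PNat.recOn n (fun j hj => ?_) fun n ih j hj => ?_
  · have hj0 : j ≠ 0 := fun h => (w 1).zero_notMem (h ▸ hj)
    exact Int.one_le_abs hj0
  · obtain ⟨i, hi⟩ := (w n).nonempty
    have h1 := hw.2 n i hi j hj
    have h2 := ih i hi
    rw [abs_of_pos ((hw.1 n).1 i hi)] at h2
    rw [abs_of_pos ((hw.1 (n + 1)).1 j hj), PNat.add_coe, PNat.one_coe, Nat.cast_add,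
      Nat.cast_one]
    lia

theorem R₁_of_abs_lt {w u : LocWord A} (hu : u ∈ LtildeVar₀ α k υ)
    (h : ∀ i ∈ w.dom, ∀ j ∈ u.dom, |i| < |j|) : R₁ w u := by
  obtain ⟨-, ⟨i, hi, -⟩, j, hj, -⟩ := hu
  refine ⟨u.domNeg, u.domPos, ⟨i, hi⟩, ⟨j, hj⟩, ?_, ?_, ?_⟩
  · ext n
    simp only [domNeg, domPos, Finset.mem_union, Finset.mem_filter]
    have : n ∈ u.dom → n ≠ 0 := fun hn h0 => u.zero_notMem (h0 ▸ hn)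
    grind
  · intro a ha n hn
    obtain ⟨ha, ha'⟩ := Finset.mem_filter.1 ha
    have := h n hn a ha
    rw [abs_of_neg ha'] at this
    linarith [neg_abs_le n]
  · intro n hn b hb
    obtain ⟨hb, hb'⟩ := Finset.mem_filter.1 hb
    have := h n hn b hb
    rw [abs_of_pos hb'] at this
    linarith [le_abs_self n]

theorem R₂_of_abs_lt {w u : LocWord A} (hu : ∀ n ∈ u.dom, 0 < n)
    (h : ∀ i ∈ w.dom, ∀ j ∈ u.dom, |i| < |j|) : R₂ w u := by
  intro n hn m hm
  have := h n hn m hm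
  rw [abs_of_pos (hu m hm)] at this
  linarith [le_abs_self n]

/-- Lets the limit along `U` be taken on the whole semigroup of words; the values off `T` are
irrelevant. -/
theorem exists_extension {B X : Type*} {T : Set B} (hT : T.Nonempty) (x : T → X) :
    ∃ x' : B → X, ∀ z : T, x' z = x z := by
  obtain ⟨t, ht⟩ := hT
  exact ⟨Function.extend Subtype.val x fun _ => x ⟨t, ht⟩,
    fun z => Subtype.val_injective.extend_apply _ _ z⟩

theorem IsSubstitutionSystem.const_nonempty {P : Type*} {f : P → ℤ → A} {F : ℕ+ → Finset P}
    {K W : Set (LocWord A)} (hS : IsSubstitutionSystem υ f F K W) {z : LocWord A} (hz : z ∈ W) :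
    K.Nonempty := by
  obtain ⟨b, hb⟩ := hS.nonempty
  exact ⟨_, hS.replaceVar_var 1 b hb z hz fun j hj =>
    Int.one_le_abs fun h => z.zero_notMem (h ▸ hj)⟩

end Instances
end LocWord

/-! ### The theorem, by specialising the abstract limit theorem. -/

theorem theorem3 {X : Type*} [MetricSpace X] [CompactSpace X] {A : Type*}
    (α : ℤ → A) (k : ℤ → ℕ) (υ : A)
    (hk : ∀ n : ℤ, n ≠ 0 → 1 ≤ k n)
    (hk_pos : ∀ m n : ℤ, 0 < m → m ≤ n → k m ≤ k n)
    (hk_neg : ∀ m n : ℤ, 0 < m → m ≤ n → k (-m) ≤ k (-n))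
    (hυ : ∀ n : ℤ, n ≠ 0 → α n ≠ υ) :
    (∀ w ∈ LocWord.LtildeInf α k υ, ∀ x : LocWord.Ltilde α k → X,
      ∃ u : ℕ+ → LocWord A, LocWord.ExtractionTilde α k υ u w ∧
        ∃ x₀ : X, LocWord.R₁Lim (LocWord.Etilde α k υ u) x x₀) ∧
    (∀ w ∈ LocWord.LInf α k υ, ∀ x : LocWord.L α k → X,
      ∃ u : ℕ+ → LocWord A, LocWord.Extraction α k υ u w ∧
        ∃ x₀ : X, LocWord.R₂Lim (LocWord.E α k υ u) x x₀) := by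
  constructor
  · intro w hw x
    have hS := LocWord.isSubstitutionSystem_tilde hk hk_pos hk_neg hυ
    obtain ⟨x', hx'⟩ := LocWord.exists_extension (hS.const_nonempty (hw.1 1)) x
    obtain ⟨u, hu, hlt, x₀, hlim⟩ :=
      hS.exists_extraction x' hw.1 (LocWord.le_abs_of_mem_LtildeInf hw)
    refine ⟨u, ⟨⟨fun n => (hu n).1, fun n => LocWord.R₁_of_abs_lt (hu (n + 1)).1 (hlt n)⟩,
      fun n => ⟨(hu n).1, ?_⟩⟩, x₀, fun O hO => ?_⟩
    · obtain ⟨m, l, s, h1, -, h3, h4, h5⟩ := (hu n).2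
      refine ⟨m, l, s, h1, fun i hi p q hs => LocWord.mem_pairs.1 (h3 i hi _ hs), ?_, ?_⟩
      · simpa [or_iff_not_imp_left] using h4
      · simpa only [LocWord.replaceOpt_pairLetter] using h5
    · obtain ⟨N, hN⟩ := hlim O hO
      refine ⟨N, ?_⟩
      rintro ⟨z, hz⟩ ⟨-, n, l, s, hl, hs, hzs⟩ hneg hpos hmin
      rw [← hx']
      have := hN n l s hl (fun m hm => LocWord.mem_pairs.2 (hs m hm))
      change _ → x' _ ∈ O at this
      subst hzs
      refine this fun j hj => ?_
      -- The two bounds in the minimum say together that every position has absolute value at least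
      -- `N`.
      rw [le_min_iff] at hmin
      rcases lt_trichotomy j 0 with h | h | h
      · have := Finset.le_max' _ j (Finset.mem_filter.2 ⟨hj, h⟩ : j ∈ LocWord.domNeg _)
        rw [abs_of_neg h]
        exact hmin.1.trans (neg_le_neg this)
      · exact absurd (h ▸ hj) (LocWord.zero_notMem _)
      · rw [abs_of_pos h]
        exact hmin.2.trans (Finset.min'_le _ j (Finset.mem_filter.2 ⟨hj, h⟩))
  · intro w hw x
    have hS := LocWord.isSubstitutionSystem_pos hk hk_pos hυ
    obtain ⟨x', hx'⟩ := LocWord.exists_extension (hS.const_nonempty (hw.1 1)) x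
    obtain ⟨u, hu, hlt, x₀, hlim⟩ :=
      hS.exists_extraction x' hw.1 (LocWord.le_abs_of_mem_LInf hw)
    refine ⟨u, ⟨⟨fun n => (hu n).1, fun n => LocWord.R₂_of_abs_lt (hu (n + 1)).1.1 (hlt n)⟩,
      fun n => ⟨(hu n).1, ?_⟩⟩, x₀, fun O hO => ?_⟩
    · obtain ⟨m, l, s, h1, -, h3, h4, h5⟩ := (hu n).2
      refine ⟨m, l, s, h1, fun i hi p hs => Finset.mem_Icc.1 (h3 i hi _ hs), ?_, ?_⟩
      · simpa [or_iff_not_imp_left] using h4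
      · simpa only [LocWord.replaceOpt_nat] using h5
    · obtain ⟨N, hN⟩ := hlim O hO
      refine ⟨N, ?_⟩
      rintro ⟨z, hz⟩ ⟨-, n, l, s, hl, hs, hzs⟩ hmin
      rw [← hx']
      have := hN n l s hl (fun m hm => Finset.mem_Icc.2 (hs m hm))
      subst hzs
      exact this fun j hj =>
        hmin.trans ((Finset.min'_le _ j hj).trans (le_abs_self j))
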